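/- Let $n \ge 2$ be an integer and let $A$ be an alphabet with $n$ letters. A right ideal of the free monoid $A^*$ is a set $R\subseteq A^*$ with $RA^*\subseteq R$; it is essential if it meets every nonempty right ideal of $A^*$, and finitely generated if $R=\Gamma A^*$ for some finite $\Gamma$. A right-ideal isomorphism is a bijection $\varphi:R_1\to R_2$ between right ideals with $\varphi(ux)=\varphi(u)x$ for all $u\in R_1$, $x\in A^*$; it is maximal if no right-ideal isomorphism of $A^*$ strictly extends it. Every isomorphism $\varphi$ between essential right ideals has a unique maximum extension $\max\varphi$. The Thompson--Higman group $G_{n,1}$ is the set of all maximal isomorphisms between finitely generated essential right ideals of $A^*$, with product $\varphi\cdot\psi=\max(\varphi\circ\psi)$ ($\psi$ applied first), and $V=G_{2,1}$ is the Thompson group. The Cuntz (or Cuntz--Dixmier) algebra $\mathcal{O}_n$ is the universal unital C$^*$-algebra generated by $s_1,\dots,s_n$ subject to $s_i^*s_i=1$, $s_i^*s_j=0$ for $i\neq j$, and $\sum_{i=1}^n s_is_i^*=1$. Then $V$ is isomorphic to a subgroup of the group of invertible elements of $\mathcal{O}_2$. More generally, for every $n\ge 2$, the group $G_{n,1}$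 is isomorphic to a subgroup of the group of invertible elements of $\mathcal{O}_n$. -/

import Mathlib

open scoped ENNReal CStarAlgebra

/-! ## Words, right ideals and right-ideal isomorphisms

Words over the alphabet `A` are lists; the free monoid `A^*` is `List A` with concatenation `++`.
-/

section ThompsonHigman

variable {A : Type*}

/-- `R ⊆ A^*` is a right ideal: `R · A^* ⊆ R`. -/
def IsRightIdeal (R : Set (List A)) : Prop :=
  ∀ u ∈ R, ∀ x : List A, u ++ x ∈ R

/-- `R ⊆ A^*` is an essential right ideal: a right ideal that meets every (nonempty) right
ideal of `A^*`. -/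
def IsEssentialRightIdeal (R : Set (List A)) : Prop :=
  IsRightIdeal R ∧ ∀ J : Set (List A), IsRightIdeal J → J.Nonempty → (R ∩ J).Nonempty

/-- The right ideal `R` is finitely generated: `R = Γ · A^*` for some finite `Γ`. -/
def IsFGRightIdeal (R : Set (List A)) : Prop :=
  ∃ Γ : Set (List A), Γ.Finite ∧ R = {w | ∃ γ ∈ Γ, ∃ x : List A, w = γ ++ x}

/-- The domain of a partial bijection of `A^*`. -/
def pdom (φ : List A ≃. List A) : Set (List A) := {u | ∃ v, v ∈ φ u}

/-- The image of a partial bijection of `A^*`. -/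
def pim (φ : List A ≃. List A) : Set (List A) := {v | ∃ u, v ∈ φ u}

/-- A right-ideal isomorphism of `A^*`: a bijection `φ : R₁ → R₂` between right ideals of `A^*`
with `φ (u x) = φ (u) x` for all `u ∈ R₁` and `x ∈ A^*`. -/
structure IsRightIdealIso (φ : List A ≃. List A) : Prop where
  dom : IsRightIdeal (pdom φ)
  im : IsRightIdeal (pim φ)
  map_append : ∀ u v : List A, v ∈ φ u → ∀ x : List A, v ++ x ∈ φ (u ++ x)

/-- A right-ideal isomorphism between finitely generated essential right ideals. -/
structure IsFGEssentialIso (φ : List A ≃. List A) : Prop where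
  iso : IsRightIdealIso φ
  essential_dom : IsEssentialRightIdeal (pdom φ)
  essential_im : IsEssentialRightIdeal (pim φ)
  fg_dom : IsFGRightIdeal (pdom φ)
  fg_im : IsFGRightIdeal (pim φ)

/-- A right-ideal isomorphism is maximal if no right-ideal isomorphism extends it strictly
(`≤` on partial bijections is extension). -/
def IsMaximalIso (φ : List A ≃. List A) : Prop :=
  ∀ ψ : List A ≃. List A, IsRightIdealIso ψ → φ ≤ ψ → ψ = φ

/-- `ψ` is the maximum extension of `φ`: a right-ideal isomorphism that extends `φ` and every
right-ideal isomorphism extending `φ`. -/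
def IsMaxExtension (φ ψ : List A ≃. List A) : Prop :=
  IsGreatest {χ | IsRightIdealIso χ ∧ φ ≤ χ} ψ

open Classical in
/-- The maximum extension `max φ` of `φ`. It exists when `φ` is an isomorphism between essential
right ideals (see `isMaxExtension_maxExt`); otherwise the value is irrelevant. -/
noncomputable def maxExt (φ : List A ≃. List A) : List A ≃. List A :=
  if h : ∃ ψ, IsMaxExtension φ ψ then h.choose else ⊥

theorem IsMaxExtension.maxExt_eq {φ ψ : List A ≃. List A} (h : IsMaxExtension φ ψ) :
    maxExt φ = ψ := by
  have h' : ∃ ψ, IsMaxExtension φ ψ := ⟨ψ, h⟩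
  unfold maxExt
  rw [dif_pos h']
  exact h'.choose_spec.unique h

theorem pdom_symm (φ : List A ≃. List A) : pdom φ.symm = pim φ := by
  ext v; simp only [pdom, pim, Set.mem_ofPred_eq, PEquiv.mem_iff_mem]

theorem pim_symm (φ : List A ≃. List A) : pim φ.symm = pdom φ := by
  ext v; simp only [pdom, pim, Set.mem_ofPred_eq, PEquiv.mem_iff_mem]

theorem IsRightIdealIso.symm {φ : List A ≃. List A} (h : IsRightIdealIso φ) :
    IsRightIdealIso φ.symm where
  dom := by rw [pdom_symm]; exact h.im
  im := by rw [pim_symm]; exact h.dom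
  map_append u v hv x := by
    rw [PEquiv.mem_iff_mem] at hv ⊢
    exact h.map_append _ _ hv x

theorem IsRightIdealIso.of_map_append {φ : List A ≃. List A}
    (h : ∀ u v : List A, v ∈ φ u → ∀ x : List A, v ++ x ∈ φ (u ++ x)) : IsRightIdealIso φ where
  dom := fun u ⟨v, hv⟩ x => ⟨v ++ x, h u v hv x⟩
  im := fun v ⟨u, hu⟩ x => ⟨u ++ x, h u v hu x⟩
  map_append := h

theorem IsFGEssentialIso.symm {φ : List A ≃. List A} (h : IsFGEssentialIso φ) :
    IsFGEssentialIso φ.symm where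
  iso := h.iso.symm
  essential_dom := by rw [pdom_symm]; exact h.essential_im
  essential_im := by rw [pim_symm]; exact h.essential_dom
  fg_dom := by rw [pdom_symm]; exact h.fg_im
  fg_im := by rw [pim_symm]; exact h.fg_dom

theorem PEquiv.symm_le_symm_of_le {φ ψ : List A ≃. List A} (h : φ ≤ ψ) : φ.symm ≤ ψ.symm := by
  intro a b hb
  rw [PEquiv.mem_iff_mem] at hb ⊢
  exact h _ _ hb

theorem IsMaximalIso.symm {φ : List A ≃. List A} (h : IsMaximalIso φ) : IsMaximalIso φ.symm := by
  intro ψ hψ hle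
  have := h ψ.symm hψ.symm (by simpa using PEquiv.symm_le_symm_of_le hle)
  rw [← this, PEquiv.symm_symm]

theorem essential_iff {R : Set (List A)} (hR : IsRightIdeal R) :
    IsEssentialRightIdeal R ↔ ∀ u : List A, ∃ x : List A, u ++ x ∈ R := by
  constructor
  · rintro ⟨-, h⟩ u
    obtain ⟨w, hw, x, rfl⟩ := h {w | ∃ x, w = u ++ x}
      (by rintro _ ⟨x, rfl⟩ y; exact ⟨x ++ y, by simp⟩) ⟨u, [], by simp⟩
    exact ⟨x, hw⟩
  · intro h
    refine ⟨hR, fun J hJ ⟨u, hu⟩ => ?_⟩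
    obtain ⟨x, hx⟩ := h u
    exact ⟨u ++ x, hx, hJ u hu x⟩

/-- An isomorphism between essential right ideals has a maximum extension, namely the union of
all its extensions. -/
theorem exists_isMaxExtension {φ : List A ≃. List A} (hφ : IsRightIdealIso φ)
    (hd : IsEssentialRightIdeal (pdom φ)) (hi : IsEssentialRightIdeal (pim φ)) :
    ∃ ψ, IsMaxExtension φ ψ := by
  classical
  have key : ∀ φ : List A ≃. List A, IsEssentialRightIdeal (pdom φ) →
      ∀ ψ₁ ψ₂ : List A ≃. List A, IsRightIdealIso ψ₁ → IsRightIdealIso ψ₂ → φ ≤ ψ₁ → φ ≤ ψ₂ →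
      ∀ u v₁ v₂, v₁ ∈ ψ₁ u → v₂ ∈ ψ₂ u → v₁ = v₂ := by
    intro φ hd ψ₁ ψ₂ h₁ h₂ l₁ l₂ u v₁ v₂ m₁ m₂
    obtain ⟨x, w, hw⟩ := (essential_iff hd.1).1 hd u
    have e₁ := Option.mem_unique (l₁ _ _ hw) (h₁.map_append _ _ m₁ x)
    have e₂ := Option.mem_unique (l₂ _ _ hw) (h₂.map_append _ _ m₂ x)
    exact List.append_cancel_right (e₁.symm.trans e₂)
  let r : List A → List A → Prop := fun u v =>
    ∃ ψ : List A ≃. List A, IsRightIdealIso ψ ∧ φ ≤ ψ ∧ v ∈ ψ u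
  have r_right : ∀ u v₁ v₂, r u v₁ → r u v₂ → v₁ = v₂ := by
    rintro u v₁ v₂ ⟨ψ₁, h₁, l₁, m₁⟩ ⟨ψ₂, h₂, l₂, m₂⟩
    exact key φ hd ψ₁ ψ₂ h₁ h₂ l₁ l₂ u v₁ v₂ m₁ m₂
  have r_left : ∀ u₁ u₂ v, r u₁ v → r u₂ v → u₁ = u₂ := by
    rintro u₁ u₂ v ⟨ψ₁, h₁, l₁, m₁⟩ ⟨ψ₂, h₂, l₂, m₂⟩
    exact key φ.symm (by rwa [pdom_symm]) ψ₁.symm ψ₂.symm h₁.symm h₂.symm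
      (PEquiv.symm_le_symm_of_le l₁) (PEquiv.symm_le_symm_of_le l₂) v u₁ u₂
      ((PEquiv.mem_iff_mem _).2 m₁) ((PEquiv.mem_iff_mem _).2 m₂)
  let f : List A → Option (List A) := fun u => if h : ∃ v, r u v then some h.choose else none
  let g : List A → Option (List A) := fun v => if h : ∃ u, r u v then some h.choose else none
  have hf : ∀ u v, f u = some v ↔ r u v := by
    intro u v
    by_cases h : ∃ v, r u v
    · simp only [f, dif_pos h, Option.some.injEq]
      exact ⟨fun e => e ▸ h.choose_spec, fun m => r_right _ _ _ h.choose_spec m⟩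
    · simp only [f, dif_neg h, reduceCtorEq, false_iff]
      exact fun m => h ⟨v, m⟩
  have hg : ∀ v u, g v = some u ↔ r u v := by
    intro v u
    by_cases h : ∃ u, r u v
    · simp only [g, dif_pos h, Option.some.injEq]
      exact ⟨fun e => e ▸ h.choose_spec, fun m => r_left _ _ _ h.choose_spec m⟩
    · simp only [g, dif_neg h, reduceCtorEq, false_iff]
      exact fun m => h ⟨u, m⟩
  let Ψ : List A ≃. List A := ⟨f, g, fun u v => by rw [hf, hg]⟩
  have mem : ∀ u v, v ∈ Ψ u ↔ r u v := hf
  refine ⟨Ψ, ⟨IsRightIdealIso.of_map_append ?_, ?_⟩, ?_⟩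
  · intro u v hv x
    obtain ⟨ψ, h, l, m⟩ := (mem _ _).1 hv
    exact (mem _ _).2 ⟨ψ, h, l, h.map_append _ _ m x⟩
  · intro u v hv
    exact (mem _ _).2 ⟨φ, hφ, le_rfl, hv⟩
  · rintro ψ ⟨h, l⟩ u v hv
    exact (mem _ _).2 ⟨ψ, h, l, hv⟩

theorem isMaxExtension_maxExt {φ : List A ≃. List A} (hφ : IsFGEssentialIso φ) :
    IsMaxExtension φ (maxExt φ) := by
  obtain ⟨ψ, hψ⟩ := exists_isMaxExtension hφ.iso hφ.essential_dom hφ.essential_im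
  rwa [hψ.maxExt_eq]

/-- A finitely generated essential right ideal contains all sufficiently long words. -/
theorem exists_length_bound {R : Set (List A)} (hR : IsEssentialRightIdeal R)
    (hfg : IsFGRightIdeal R) : ∃ N : ℕ, ∀ w : List A, N ≤ w.length → w ∈ R := by
  obtain ⟨Γ, hΓ, rfl⟩ := hfg
  obtain ⟨N, hN⟩ := (hΓ.image List.length).bddAbove
  refine ⟨N, fun w hw => ?_⟩
  obtain ⟨x, γ, hγ, z, hz⟩ := (essential_iff hR.1).1 hR w
  have hle : γ.length ≤ w.length := (hN ⟨γ, hγ, rfl⟩).trans hw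
  obtain ⟨t, ht⟩ := List.prefix_of_prefix_length_le ⟨z, hz.symm⟩ (List.prefix_append w x) hle
  exact ⟨γ, hγ, t, ht.symm⟩

theorem isFG_of_length_bound [Finite A] {R : Set (List A)} (hR : IsRightIdeal R)
    (h : ∃ N : ℕ, ∀ w : List A, N ≤ w.length → w ∈ R) : IsFGRightIdeal R := by
  obtain ⟨N, hN⟩ := h
  refine ⟨{w | w ∈ R ∧ w.length ≤ N}, (List.finite_length_le A N).subset fun w hw => hw.2, ?_⟩
  ext w
  constructor
  · intro hw
    rcases le_total w.length N with hl | hl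
    · exact ⟨w, ⟨hw, hl⟩, [], by simp⟩
    · refine ⟨w.take N, ⟨hN _ ?_, ?_⟩, w.drop N, by simp⟩ <;> simp [hl]
  · rintro ⟨γ, ⟨hγ, -⟩, x, rfl⟩
    exact hR γ hγ x

/-- Extensions of isomorphisms between finitely generated essential right ideals are again of
this kind. -/
theorem IsFGEssentialIso.of_le [Finite A] {φ ψ : List A ≃. List A} (hφ : IsFGEssentialIso φ)
    (hψ : IsRightIdealIso ψ) (hle : φ ≤ ψ) : IsFGEssentialIso ψ := by
  have sd : pdom φ ⊆ pdom ψ := fun u ⟨v, hv⟩ => ⟨v, hle _ _ hv⟩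
  have si : pim φ ⊆ pim ψ := fun u ⟨v, hv⟩ => ⟨v, hle _ _ hv⟩
  refine ⟨hψ, ⟨hψ.dom, fun J hJ hne => ?_⟩, ⟨hψ.im, fun J hJ hne => ?_⟩,
    isFG_of_length_bound hψ.dom ?_, isFG_of_length_bound hψ.im ?_⟩
  · exact (hφ.essential_dom.2 J hJ hne).mono (Set.inter_subset_inter_left _ sd)
  · exact (hφ.essential_im.2 J hJ hne).mono (Set.inter_subset_inter_left _ si)
  · obtain ⟨N, hN⟩ := exists_length_bound hφ.essential_dom hφ.fg_dom
    exact ⟨N, fun w hw => sd (hN w hw)⟩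
  · obtain ⟨N, hN⟩ := exists_length_bound hφ.essential_im hφ.fg_im
    exact ⟨N, fun w hw => si (hN w hw)⟩

theorem trans_dom_aux [Finite A] {φ ψ : List A ≃. List A} (hφ : IsFGEssentialIso φ)
    (hψ : IsFGEssentialIso ψ) (hiso : IsRightIdealIso (φ.trans ψ)) :
    IsEssentialRightIdeal (pdom (φ.trans ψ)) ∧ IsFGRightIdeal (pdom (φ.trans ψ)) := by
  constructor
  · rw [essential_iff hiso.dom]
    intro u
    obtain ⟨x, v, hv⟩ := (essential_iff hφ.iso.dom).1 hφ.essential_dom u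
    obtain ⟨y, w, hw⟩ := (essential_iff hψ.iso.dom).1 hψ.essential_dom v
    refine ⟨x ++ y, w, (PEquiv.mem_trans _ _ _ _).2 ⟨v ++ y, ?_, hw⟩⟩
    rw [← List.append_assoc]
    exact hφ.iso.map_append _ _ hv y
  · refine isFG_of_length_bound hiso.dom ?_
    obtain ⟨N₁, h₁⟩ := exists_length_bound hφ.essential_dom hφ.fg_dom
    obtain ⟨N₂, h₂⟩ := exists_length_bound hψ.essential_dom hψ.fg_dom
    refine ⟨N₁ + N₂, fun w hw => ?_⟩
    obtain ⟨v, hv⟩ := h₁ (w.take N₁) (by simp; omega)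
    obtain ⟨z, hz⟩ := h₂ (v ++ w.drop N₁) (by simp; omega)
    refine ⟨z, (PEquiv.mem_trans _ _ _ _).2 ⟨v ++ w.drop N₁, ?_, hz⟩⟩
    have := hφ.iso.map_append _ _ hv (w.drop N₁)
    rwa [List.take_append_drop] at this

theorem IsRightIdealIso.trans {φ ψ : List A ≃. List A} (hφ : IsRightIdealIso φ)
    (hψ : IsRightIdealIso ψ) : IsRightIdealIso (φ.trans ψ) := by
  refine IsRightIdealIso.of_map_append fun u w hw x => ?_
  obtain ⟨v, hv, hw⟩ := (PEquiv.mem_trans _ _ _ _).1 hw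
  exact (PEquiv.mem_trans _ _ _ _).2 ⟨v ++ x, hφ.map_append _ _ hv x, hψ.map_append _ _ hw x⟩

theorem IsFGEssentialIso.trans [Finite A] {φ ψ : List A ≃. List A} (hφ : IsFGEssentialIso φ)
    (hψ : IsFGEssentialIso ψ) : IsFGEssentialIso (φ.trans ψ) := by
  have hiso := hφ.iso.trans hψ.iso
  have hd := trans_dom_aux hφ hψ hiso
  have hi := trans_dom_aux hψ.symm hφ.symm
    (by rw [← PEquiv.symm_trans_rev]; exact hiso.symm)
  rw [← PEquiv.symm_trans_rev, pdom_symm] at hi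
  exact ⟨hiso, hd.1, hi.1, hd.2, hi.2⟩

theorem isFGEssentialIso_refl : IsFGEssentialIso (PEquiv.refl (List A)) := by
  have hd : pdom (PEquiv.refl (List A)) = Set.univ :=
    Set.eq_univ_of_forall fun u => ⟨u, rfl⟩
  have hi : pim (PEquiv.refl (List A)) = Set.univ :=
    Set.eq_univ_of_forall fun u => ⟨u, rfl⟩
  have he : IsEssentialRightIdeal (Set.univ : Set (List A)) :=
    ⟨fun _ _ _ => trivial, fun J _ hne => by simpa using hne⟩
  have hfg : IsFGRightIdeal (Set.univ : Set (List A)) :=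
    ⟨{[]}, Set.finite_singleton _, by ext; simp⟩
  refine ⟨IsRightIdealIso.of_map_append ?_, ?_, ?_, ?_, ?_⟩
  · intro u v hv x
    have : u = v := Option.some.inj hv
    subst this
    rfl
  all_goals simpa only [hd, hi]

theorem isMaximalIso_refl : IsMaximalIso (PEquiv.refl (List A)) := by
  intro ψ _ hle
  ext1 u
  exact hle u u rfl

theorem IsMaxExtension.isMaximalIso {φ ψ : List A ≃. List A} (h : IsMaxExtension φ ψ) :
    IsMaximalIso ψ :=
  fun _ hχ hle => le_antisymm (h.2 ⟨hχ, h.1.2.trans hle⟩) hle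

theorem maxExt_of_isMaximalIso {φ : List A ≃. List A} (hφ : IsFGEssentialIso φ)
    (hm : IsMaximalIso φ) : maxExt φ = φ :=
  hm _ (isMaxExtension_maxExt hφ).1.1 (isMaxExtension_maxExt hφ).1.2

/-- If `β` extends `α` then `max α = max β`. -/
theorem maxExt_eq_of_le {α β : List A ≃. List A} (hα : IsFGEssentialIso α)
    (hβ : IsFGEssentialIso β) (hle : α ≤ β) : maxExt α = maxExt β := by
  have h₁ := isMaxExtension_maxExt hα
  have h₂ := isMaxExtension_maxExt hβ
  exact (h₂.isMaximalIso _ h₁.1.1 (h₁.2 ⟨h₂.1.1, hle.trans h₂.1.2⟩))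

theorem PEquiv.trans_le_trans_of_le {α α' β β' : List A ≃. List A} (h : α ≤ α') (h' : β ≤ β') :
    α.trans β ≤ α'.trans β' := by
  intro u w hw
  obtain ⟨v, hv, hw⟩ := (PEquiv.mem_trans _ _ _ _).1 hw
  exact (PEquiv.mem_trans _ _ _ _).2 ⟨v, h _ _ hv, h' _ _ hw⟩

/-- The Thompson-Higman group over the alphabet `A`, as a set: all maximal isomorphisms between
finitely generated essential right ideals of `A^*`. -/
def ThompsonHigmanOver (A : Type*) : Type _ :=
  {φ : List A ≃. List A // IsFGEssentialIso φ ∧ IsMaximalIso φ}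

/-- Product `φ · ψ = max (φ ∘ ψ)` (with `ψ` applied first). -/
noncomputable instance [Finite A] : Mul (ThompsonHigmanOver A) where
  mul φ ψ := ⟨maxExt (ψ.1.trans φ.1),
    (ψ.2.1.trans φ.2.1).of_le (isMaxExtension_maxExt (ψ.2.1.trans φ.2.1)).1.1
      (isMaxExtension_maxExt (ψ.2.1.trans φ.2.1)).1.2,
    (isMaxExtension_maxExt (ψ.2.1.trans φ.2.1)).isMaximalIso⟩

instance : One (ThompsonHigmanOver A) where
  one := ⟨PEquiv.refl _, isFGEssentialIso_refl, isMaximalIso_refl⟩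

instance : Inv (ThompsonHigmanOver A) where
  inv φ := ⟨φ.1.symm, φ.2.1.symm, φ.2.2.symm⟩

theorem ThompsonHigmanOver.mul_val [Finite A] (φ ψ : ThompsonHigmanOver A) :
    (φ * ψ).1 = maxExt (ψ.1.trans φ.1) := rfl

theorem ThompsonHigmanOver.one_val : (1 : ThompsonHigmanOver A).1 = PEquiv.refl _ := rfl

theorem ThompsonHigmanOver.inv_val (φ : ThompsonHigmanOver A) : (φ⁻¹).1 = φ.1.symm := rfl

noncomputable instance [Finite A] : Group (ThompsonHigmanOver A) :=
  Group.ofLeftAxioms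
    (by
      intro α β γ
      apply Subtype.ext
      simp only [ThompsonHigmanOver.mul_val]
      have h₁ := β.2.1.trans α.2.1
      have h₂ := γ.2.1.trans β.2.1
      have e₁ := isMaxExtension_maxExt h₁
      have e₂ := isMaxExtension_maxExt h₂
      rw [← maxExt_eq_of_le (γ.2.1.trans h₁) (γ.2.1.trans (h₁.of_le e₁.1.1 e₁.1.2))
          (PEquiv.trans_le_trans_of_le le_rfl e₁.1.2),
        ← maxExt_eq_of_le (h₂.trans α.2.1) ((h₂.of_le e₂.1.1 e₂.1.2).trans α.2.1)
          (PEquiv.trans_le_trans_of_le e₂.1.2 le_rfl), PEquiv.trans_assoc])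
    (by
      intro α
      apply Subtype.ext
      rw [ThompsonHigmanOver.mul_val, ThompsonHigmanOver.one_val, PEquiv.trans_refl,
        maxExt_of_isMaximalIso α.2.1 α.2.2])
    (by
      intro α
      apply Subtype.ext
      rw [ThompsonHigmanOver.mul_val, ThompsonHigmanOver.inv_val, ThompsonHigmanOver.one_val,
        maxExt_eq_of_le (α.2.1.trans α.2.1.symm) isFGEssentialIso_refl
          (by
            intro u w hw
            obtain ⟨v, hv, hw⟩ := (PEquiv.mem_trans _ _ _ _).1 hw
            rw [PEquiv.mem_iff_mem] at hw
            rw [PEquiv.inj _ hv hw]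
            rfl),
        maxExt_of_isMaximalIso isFGEssentialIso_refl isMaximalIso_refl])

/-- The Thompson-Higman group `G_{n,1}`: the alphabet has `n` letters. -/
abbrev ThompsonHigman (n : ℕ) : Type := ThompsonHigmanOver (Fin n)

/-- The Thompson group `V`: the alphabet `{a, b}` has two letters. -/
abbrev ThompsonV : Type := ThompsonHigman 2

end ThompsonHigman

/-! ## The Cuntz algebra `O_n` -/

section Cuntz

/-- The Cuntz relations for `s_1, …, s_n` in a unital `*`-algebra:
`s_i^* s_i = 1`, `s_i^* s_j = 0` for `i ≠ j`, and `∑ i, s_i s_i^* = 1`. -/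
structure IsCuntzFamily {n : ℕ} {B : Type*} [Ring B] [StarRing B] (s : Fin n → B) : Prop where
  star_mul_self : ∀ i, star (s i) * s i = 1
  star_mul_of_ne : ∀ i j, i ≠ j → star (s i) * s j = 0
  sum_mul_star : ∑ i, s i * star (s i) = 1

/-- A representation of the Cuntz relations in some nonzero unital C*-algebra. -/
structure CuntzRep (n : ℕ) where
  /-- the C*-algebra -/
  carrier : Type
  [cstar : CStarAlgebra carrier]
  [nontrivial : Nontrivial carrier]
  /-- the generators -/
  gen : Fin n → carrier
  isCuntz : IsCuntzFamily gen

attribute [instance] CuntzRep.cstar CuntzRep.nontrivial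

/-- The C*-algebra of bounded families indexed by all representations of the Cuntz relations. -/
def CuntzProduct (n : ℕ) : Type 1 := lp (fun ρ : CuntzRep n => ρ.carrier) ∞

/-- Bounded families in unital C*-algebras form a unital C*-algebra, with pointwise operations
and the supremum norm. -/
noncomputable def lpCStarAlgebra {I : Type*} (B : I → Type*) [∀ i, CStarAlgebra (B i)]
    [∀ i, Nontrivial (B i)] : CStarAlgebra (lp B ∞) where

noncomputable instance (n : ℕ) : CStarAlgebra (CuntzProduct n) :=
  lpCStarAlgebra fun ρ : CuntzRep n => ρ.carrier

theorem norm_le_one_of_star_mul_self {B : Type*} [CStarAlgebra B] [Nontrivial B] {x : B}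
    (h : star x * x = 1) : ‖x‖ ≤ 1 := by
  have h' := CStarRing.norm_star_mul_self (x := x)
  rw [h, norm_one] at h'
  nlinarith [norm_nonneg x]

/-- Evaluation of a bounded family in one of the representations. -/
noncomputable def CuntzProduct.eval {n : ℕ} (ρ : CuntzRep n) :
    CuntzProduct n →⋆ₐ[ℂ] ρ.carrier where
  toFun x := (show lp (fun ρ : CuntzRep n => ρ.carrier) ∞ from x) ρ
  map_one' := rfl
  map_mul' _ _ := rfl
  map_zero' := rfl
  map_add' _ _ := rfl
  commutes' _ := rfl
  map_star' _ := rfl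

theorem CuntzProduct.ext {n : ℕ} {x y : CuntzProduct n}
    (h : ∀ ρ, CuntzProduct.eval ρ x = CuntzProduct.eval ρ y) : x = y :=
  lp.ext (funext h)

/-- The universal generators: in each representation, the generators of that representation. -/
noncomputable def cuntzProductGen (n : ℕ) (i : Fin n) : CuntzProduct n :=
  ⟨fun ρ => ρ.gen i, memℓp_infty ⟨1, by
    rintro _ ⟨ρ, rfl⟩
    exact norm_le_one_of_star_mul_self (ρ.isCuntz.star_mul_self i)⟩⟩

/-- The Cuntz algebra `O_n`, the universal unital C*-algebra on generators `s_1, …, s_n` subject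
to the Cuntz relations: the completion (here, closure) of the `*`-algebra generated by
`s_1, …, s_n` in the C*-norm `‖x‖ = sup_ρ ‖ρ(x)‖`, over all representations `ρ` of the Cuntz
relations in unital C*-algebras. (A C*-algebra generated by finitely many elements is separable,
so restricting to C*-algebras in `Type` loses no representation.) -/
noncomputable def cuntzSubalgebra (n : ℕ) : StarSubalgebra ℂ (CuntzProduct n) :=
  (StarAlgebra.adjoin ℂ (Set.range (cuntzProductGen n))).topologicalClosure

/-- The Cuntz algebra `O_n` as a type. -/
def CuntzAlgebra (n : ℕ) : Type 1 := cuntzSubalgebra n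

/-- `O_n` is a C*-algebra, as a closed `*`-subalgebra of a C*-algebra. -/
noncomputable def cuntzCStarAlgebra (n : ℕ) : CStarAlgebra (CuntzAlgebra n) :=
  StarSubalgebra.cstarAlgebra (cuntzSubalgebra n)
    (h_closed := StarSubalgebra.isClosed_topologicalClosure _)

noncomputable instance (n : ℕ) : CStarAlgebra (CuntzAlgebra n) := cuntzCStarAlgebra n

/-- The generators of `O_n`. -/
noncomputable def cuntzGen (n : ℕ) (i : Fin n) : CuntzAlgebra n :=
  ⟨cuntzProductGen n i, StarSubalgebra.le_topologicalClosure _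
    (StarAlgebra.subset_adjoin ℂ _ ⟨i, rfl⟩)⟩

/-- The inclusion of `O_n` into the product. -/
noncomputable def CuntzAlgebra.toProduct (n : ℕ) : CuntzAlgebra n →⋆ₐ[ℂ] CuntzProduct n :=
  (cuntzSubalgebra n).subtype

theorem CuntzAlgebra.toProduct_injective (n : ℕ) :
    Function.Injective (CuntzAlgebra.toProduct n) := Subtype.val_injective

/-- Evaluation of elements of `O_n` in a representation of the Cuntz relations. -/
noncomputable def CuntzAlgebra.eval {n : ℕ} (ρ : CuntzRep n) : CuntzAlgebra n →⋆ₐ[ℂ] ρ.carrier :=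
  (CuntzProduct.eval ρ).comp (CuntzAlgebra.toProduct n)

theorem CuntzAlgebra.eval_gen {n : ℕ} (ρ : CuntzRep n) (i : Fin n) :
    CuntzAlgebra.eval ρ (cuntzGen n i) = ρ.gen i := rfl

theorem CuntzAlgebra.ext {n : ℕ} {x y : CuntzAlgebra n}
    (h : ∀ ρ, CuntzAlgebra.eval ρ x = CuntzAlgebra.eval ρ y) : x = y :=
  CuntzAlgebra.toProduct_injective n (CuntzProduct.ext h)

/-- The generators of `O_n` satisfy the Cuntz relations. -/
theorem isCuntzFamily_cuntzGen (n : ℕ) : IsCuntzFamily (cuntzGen n) where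
  star_mul_self i := CuntzAlgebra.ext fun ρ => by
    simpa [map_star, CuntzAlgebra.eval_gen] using ρ.isCuntz.star_mul_self i
  star_mul_of_ne i j hij := CuntzAlgebra.ext fun ρ => by
    simpa [map_star, CuntzAlgebra.eval_gen] using ρ.isCuntz.star_mul_of_ne i j hij
  sum_mul_star := CuntzAlgebra.ext fun ρ => by
    simpa [map_star, CuntzAlgebra.eval_gen] using ρ.isCuntz.sum_mul_star

/-- The universal property of `O_n`. -/
theorem existsUnique_starAlgHom_of_isCuntzFamily {n : ℕ} {B : Type} [CStarAlgebra B]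
    (t : Fin n → B) (ht : IsCuntzFamily t) :
    ∃! π : CuntzAlgebra n →⋆ₐ[ℂ] B, ∀ i, π (cuntzGen n i) = t i := by
  refine existsUnique_of_exists_of_unique ?_ ?_
  · rcases subsingleton_or_nontrivial B with h | h
    · exact ⟨{ toFun := fun _ => 0
               map_one' := Subsingleton.elim _ _
               map_mul' := fun _ _ => Subsingleton.elim _ _
               map_zero' := rfl
               map_add' := fun _ _ => Subsingleton.elim _ _
               commutes' := fun _ => Subsingleton.elim _ _
               map_star' := fun _ => Subsingleton.elim _ _ }, fun _ => Subsingleton.elim _ _⟩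
    · exact ⟨CuntzAlgebra.eval ⟨B, t, ht⟩, fun _ => rfl⟩
  · intro π₁ π₂ h₁ h₂
    have c₁ : Continuous π₁ := map_continuous π₁
    have c₂ : Continuous π₂ := map_continuous π₂
    refine StarAlgHom.ext_topologicalClosure (S := StarAlgebra.adjoin ℂ _) c₁ c₂ ?_
    refine StarAlgHom.ext_adjoin ?_
    rintro ⟨_, _⟩ ⟨i, rfl⟩
    exact (h₁ i).trans (h₂ i).symm

end Cuntz

/-! For a word `w` let `s_w` be the product of the generators along `w`. The Cuntz relations say
that, for each `N`, the `s_w` with `|w| = N` are isometries whose ranges decompose the unit. So an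
element `x` is determined by the products `x s_w` with `|w| = N`, and these can be prescribed at
will.

If `φ` is an isomorphism between finitely generated essential right ideals, its domain contains
every word of some length `N`, so `x = ∑ s_{φ(w)} s_w^*` over `|w| = N` makes sense. Equivariance of
`φ` upgrades this to `x s_u = s_{φ(u)}` on the whole domain. Restricting `φ` to a smaller such ideal
still determines `x`, so replacing a composite by its maximum extension costs nothing and `φ ↦ x` is
multiplicative.

For injectivity, `n ≥ 2` and `1 ≠ 0` make `w ↦ s_w` injective; hence `x = 1` forces `φ` to be a
restriction of the identity, and maximality gives `φ = 1`. That `O_n` is nonzero is seen from a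
concrete representation on `ℓ²(ℕ)`. -/

/-! ### Words in a Cuntz family and the action of the Thompson–Higman group on them. -/

section CuntzFamily

variable {n : ℕ} {B : Type*} [Ring B] {s : Fin n → B}

/-- The product `s_{i₁} ⋯ s_{iₖ}` attached to the word `i₁ ⋯ iₖ`. -/
def wordProd (s : Fin n → B) (w : List (Fin n)) : B := (w.map s).prod

@[simp] theorem wordProd_nil : wordProd s [] = 1 := rfl

@[simp] theorem wordProd_cons (i : Fin n) (w : List (Fin n)) :
    wordProd s (i :: w) = s i * wordProd s w := by simp [wordProd]

theorem wordProd_append (u v : List (Fin n)) :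
    wordProd s (u ++ v) = wordProd s u * wordProd s v := by simp [wordProd]

variable [StarRing B]

/-- Only the orthogonality relations are assumed, since with `y = s` this also serves to establish
the relation `∑ s_i s_i^* = 1` in the Hilbert space model. -/
theorem sum_mul_star_mul_eq (h₁ : ∀ i, star (s i) * s i = 1)
    (h₂ : ∀ i j, i ≠ j → star (s i) * s j = 0) (y : Fin n → B) (i : Fin n) :
    (∑ j, y j * star (s j)) * s i = y i := by
  rw [Finset.sum_mul, Finset.sum_eq_single i]
  · rw [mul_assoc, h₁, mul_one]
  · intro j _ hj
    rw [mul_assoc, h₂ j i hj, mul_zero]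
  · simp

namespace IsCuntzFamily

/-- An element is determined by its products with the words of a given length. -/
theorem eq_of_mul_wordProd_eq (hs : IsCuntzFamily s) {x y : B} (N : ℕ)
    (h : ∀ w : List (Fin n), w.length = N → x * wordProd s w = y * wordProd s w) : x = y := by
  induction N generalizing x y with
  | zero => simpa using h [] rfl
  | succ N ih =>
    -- Peel off the first letter; then `x = ∑ (x s_i) s_i^*` recovers `x` from the `x s_i`.
    have key : ∀ i, x * s i = y * s i := fun i => ih fun w hw => by
      simpa [mul_assoc] using h (i :: w) (by simp [hw])
    rw [← mul_one x, ← mul_one y, ← hs.sum_mul_star, Finset.mul_sum, Finset.mul_sum]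
    exact Finset.sum_congr rfl fun i _ => by rw [← mul_assoc, ← mul_assoc, key]

/-- The products with the words of a given length can be prescribed. -/
theorem exists_mul_wordProd_eq (hs : IsCuntzFamily s) (N : ℕ) (g : List (Fin n) → B) :
    ∃ x : B, ∀ w : List (Fin n), w.length = N → x * wordProd s w = g w := by
  induction N generalizing g with
  | zero => exact ⟨g [], fun w hw => by simp [List.length_eq_zero_iff.1 hw]⟩
  | succ N ih =>
    choose y hy using fun i => ih fun w => g (i :: w)
    refine ⟨∑ i, y i * star (s i), fun w hw => ?_⟩
    cases w with
    | nil => simp at hw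
    | cons i w =>
      rw [wordProd_cons, ← mul_assoc, sum_mul_star_mul_eq hs.star_mul_self hs.star_mul_of_ne]
      exact hy i w (by simpa using hw)

theorem exists_mul_wordProd_eq_of_isFGEssentialIso (hs : IsCuntzFamily s)
    {φ : List (Fin n) ≃. List (Fin n)} (hφ : IsFGEssentialIso φ) :
    ∃ x : B, ∀ u v, v ∈ φ u → x * wordProd s u = wordProd s v := by
  obtain ⟨N, hN⟩ := exists_length_bound hφ.essential_dom hφ.fg_dom
  -- The default `[]` is never used on words of length `N`, all of which lie in the domain.
  obtain ⟨x, hx⟩ := hs.exists_mul_wordProd_eq N fun w => wordProd s ((φ w).getD [])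
  have hx' : ∀ w v, w.length = N → v ∈ φ w → x * wordProd s w = wordProd s v := by
    intro w v hw hv
    rw [hx w hw, Option.mem_def.1 hv, Option.getD_some]
  -- The word `u` may be shorter than `N`, so it is lengthened by `t`. Then `φ(u t)` is computed in
  -- two ways: as `φ(u) t`, and by cutting `u t` after its first `N` letters, where `x` is known.
  refine ⟨x, fun u v hv => hs.eq_of_mul_wordProd_eq N fun t ht => ?_⟩
  rw [mul_assoc, ← wordProd_append, ← wordProd_append]
  have hlen : ((u ++ t).take N).length = N := by simp; omega
  obtain ⟨v', hv'⟩ := hN ((u ++ t).take N) hlen.ge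
  have e := hφ.iso.map_append _ _ hv' ((u ++ t).drop N)
  rw [List.take_append_drop] at e
  rw [Option.mem_unique (hφ.iso.map_append _ _ hv t) e, wordProd_append v', ← hx' _ _ hlen hv',
    mul_assoc, ← wordProd_append, List.take_append_drop]

/-- Since `φ` need not be maximal, products can be compared on the domain of the bare composite. -/
theorem eq_of_isFGEssentialIso (hs : IsCuntzFamily s) {φ : List (Fin n) ≃. List (Fin n)}
    (hφ : IsFGEssentialIso φ) {x y : B} (hx : ∀ u v, v ∈ φ u → x * wordProd s u = wordProd s v)
    (hy : ∀ u v, v ∈ φ u → y * wordProd s u = wordProd s v) : x = y := by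
  obtain ⟨N, hN⟩ := exists_length_bound hφ.essential_dom hφ.fg_dom
  refine hs.eq_of_mul_wordProd_eq N fun w hw => ?_
  obtain ⟨v, hv⟩ := hN w hw.ge
  rw [hx w v hv, hy w v hv]

/-- The element `∑ s_{φ(w)} s_w^*` acting on words as `φ` does. -/
noncomputable def thompsonElement (hs : IsCuntzFamily s) (φ : ThompsonHigman n) : B :=
  (hs.exists_mul_wordProd_eq_of_isFGEssentialIso φ.2.1).choose

theorem thompsonElement_mul_wordProd (hs : IsCuntzFamily s) (φ : ThompsonHigman n)
    {u v : List (Fin n)} (h : v ∈ φ.1 u) :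
    hs.thompsonElement φ * wordProd s u = wordProd s v :=
  (hs.exists_mul_wordProd_eq_of_isFGEssentialIso φ.2.1).choose_spec u v h

/-- The homomorphism from the Thompson-Higman group to the units of an algebra with a Cuntz
family. -/
noncomputable def thompsonHom (hs : IsCuntzFamily s) : ThompsonHigman n →* Bˣ :=
  MonoidHom.toHomUnits
    { toFun := hs.thompsonElement
      map_one' := hs.eq_of_isFGEssentialIso (1 : ThompsonHigman n).2.1
        (fun _ _ h => hs.thompsonElement_mul_wordProd 1 h)
        (fun u v h => by rw [one_mul, Option.some.inj (show some u = some v from h)])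
      map_mul' := fun φ ψ => by
        have hfg := ψ.2.1.trans φ.2.1
        refine hs.eq_of_isFGEssentialIso hfg (fun u w h => ?_) fun u w h => ?_
        · exact hs.thompsonElement_mul_wordProd _ ((isMaxExtension_maxExt hfg).1.2 u w h)
        · obtain ⟨v, hv, hw⟩ := (PEquiv.mem_trans _ _ _ _).1 h
          rw [mul_assoc, hs.thompsonElement_mul_wordProd ψ hv,
            hs.thompsonElement_mul_wordProd φ hw] }

theorem coe_thompsonHom (hs : IsCuntzFamily s) (φ : ThompsonHigman n) :
    (hs.thompsonHom φ : B) = hs.thompsonElement φ := rfl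

/-! ### Injectivity. -/

/-- A letter `j ≠ i` exists because `n ≥ 2`, and `s_j^*` annihilates anything starting with `s_i`.
For `n = 1` a unitary such as `1` would be a counterexample. -/
theorem wordProd_cons_ne_one [Nontrivial B] (hs : IsCuntzFamily s) (hn : 2 ≤ n) (i : Fin n)
    (w : List (Fin n)) : wordProd s (i :: w) ≠ 1 := by
  intro h
  have : Nontrivial (Fin n) := Fin.nontrivial_iff_two_le.2 hn
  obtain ⟨j, hj⟩ := exists_ne i
  have h₀ : star (s j) = 0 := by
    rw [← mul_one (star (s j)), ← h, wordProd_cons, ← mul_assoc, hs.star_mul_of_ne j i hj,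
      zero_mul]
  have h₁ := hs.star_mul_self j
  rw [h₀, zero_mul] at h₁
  exact zero_ne_one h₁

/-- Multiplying by `s_i^*` on the left cancels a common first letter; if the first letters differ it
gives `s_u = 0`, impossible for an isometry. -/
theorem wordProd_injective [Nontrivial B] (hs : IsCuntzFamily s) (hn : 2 ≤ n) :
    Function.Injective (wordProd s) := by
  have left (w : List (Fin n)) : star (wordProd s w) * wordProd s w = 1 := by
    induction w with
    | nil => simp
    | cons i w ih =>
      rw [wordProd_cons, star_mul, mul_assoc, ← mul_assoc (star (s i)), hs.star_mul_self,
        one_mul, ih]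
  intro u
  induction u with
  | nil =>
    rintro (_ | ⟨j, v⟩) h
    · rfl
    · exact absurd h.symm (hs.wordProd_cons_ne_one hn j v)
  | cons i u ih =>
    rintro (_ | ⟨j, v⟩) h
    · exact absurd h (hs.wordProd_cons_ne_one hn i u)
    · have h' := congrArg (star (s i) * ·) h
      simp only [wordProd_cons, ← mul_assoc, hs.star_mul_self, one_mul] at h'
      by_cases hij : i = j
      · subst hij
        rw [hs.star_mul_self, one_mul] at h'
        rw [ih h']
      · rw [hs.star_mul_of_ne i j hij, zero_mul] at h'
        have := left u
        rw [h', mul_zero] at this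
        exact absurd this zero_ne_one

theorem thompsonHom_injective [Nontrivial B] (hs : IsCuntzFamily s) (hn : 2 ≤ n) :
    Function.Injective hs.thompsonHom := by
  refine (injective_iff_map_eq_one _).2 fun φ h => ?_
  have h₁ : hs.thompsonElement φ = 1 := by rw [← coe_thompsonHom, h, Units.val_one]
  -- By maximality of `φ` it suffices that the identity extends `φ`.
  refine Subtype.ext (φ.2.2 _ isFGEssentialIso_refl.iso fun u v hv => ?_).symm
  have e := hs.thompsonElement_mul_wordProd φ hv
  rw [h₁, one_mul] at e
  rw [hs.wordProd_injective hn e]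
  rfl

end IsCuntzFamily

end CuntzFamily

/-! ### Cuntz families on a Hilbert space, and nontriviality of `O_n`. -/

section HilbertSpace

open ContinuousLinearMap

variable {H : Type*} [NormedAddCommGroup H] [InnerProductSpace ℂ H]

theorem HilbertBasis.clm_ext {ι E : Type*} [NormedAddCommGroup E] [NormedSpace ℂ E]
    (b : HilbertBasis ι ℂ H) {S T : H →L[ℂ] E} (h : ∀ i, S (b i) = T (b i)) : S = T :=
  ContinuousLinearMap.ext_on (Submodule.dense_iff_topologicalClosure_eq_top.2 b.dense_span)
    (by rintro _ ⟨i, rfl⟩; exact h i)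

variable [CompleteSpace H]

/-- The isometry that maps the basis vector `b i` to `b (f i)`. -/
noncomputable def HilbertBasis.isometryOfInjective {ι : Type*} (b : HilbertBasis ι ℂ H)
    (f : ι → ι) (hf : Function.Injective f) : H →ₗᵢ[ℂ] H :=
  ((b.orthonormal.comp f hf).orthogonalFamily.linearIsometry).comp b.repr.toLinearIsometry

theorem HilbertBasis.isometryOfInjective_apply {ι : Type*} (b : HilbertBasis ι ℂ H)
    (f : ι → ι) (hf : Function.Injective f) (i : ι) :
    b.isometryOfInjective f hf (b i) = b (f i) := by
  classical
  simp [isometryOfInjective, b.repr_self, OrthogonalFamily.linearIsometry_apply_single]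

/-- The injections `k ↦ (i, k)`, read through a bijection `Fin n × ι ≃ ι`, induce a Cuntz
family. -/
theorem HilbertBasis.isCuntzFamily {n : ℕ} {ι : Type*} (b : HilbertBasis ι ℂ H)
    (e : Fin n × ι ≃ ι) :
    IsCuntzFamily fun i : Fin n => (b.isometryOfInjective (fun k => e (i, k))
      fun _ _ h => (Prod.ext_iff.1 (e.injective h)).2).toContinuousLinearMap := by
  set s : Fin n → H →L[ℂ] H := fun i => (b.isometryOfInjective (fun k => e (i, k))
      fun _ _ h => (Prod.ext_iff.1 (e.injective h)).2).toContinuousLinearMap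
  have hb : ∀ i k, s i (b k) = b (e (i, k)) := fun i k =>
    b.isometryOfInjective_apply (fun k => e (i, k))
      (fun _ _ h => (Prod.ext_iff.1 (e.injective h)).2) k
  have h₁ : ∀ i, star (s i) * s i = 1 := fun i => by
    rw [star_eq_adjoint]
    exact (norm_map_iff_adjoint_comp_self (s i)).1 fun x => LinearIsometry.norm_map _ x
  have h₂ : ∀ i j, i ≠ j → star (s i) * s j = 0 := fun i j hij => by
    refine b.clm_ext fun k => ?_
    -- Pair with each basis vector: `⟨s_i^* s_j b_k, b_l⟩ = ⟨b_{e(j,k)}, b_{e(i,l)}⟩`, which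
    -- vanishes for `i ≠ j`.
    have h : innerSL ℂ ((star (s i) * s j) (b k)) = 0 := b.clm_ext fun l => by
      rw [innerSL_apply_apply, star_eq_adjoint, mul_def, comp_apply, adjoint_inner_left, hb, hb,
        b.orthonormal.2 fun h => hij (Prod.ext_iff.1 (e.injective h)).1.symm]
      rfl
    simpa using congrArg (· ((star (s i) * s j) (b k))) h
  refine ⟨h₁, h₂, b.clm_ext fun m => ?_⟩
  -- Surjectivity of `e` makes every basis vector equal to some `s_i b_k`, and `∑ s_j s_j^*` fixes
  -- the range of `s_i`.
  obtain ⟨⟨i, k⟩, rfl⟩ := e.surjective m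
  rw [← hb]
  exact congrArg (· (b k)) (sum_mul_star_mul_eq h₁ h₂ s i)

end HilbertSpace

/-- The representation of the Cuntz relations on `ℓ²(ℕ)` with `s_i e_k = e_{nk+i}`. -/
noncomputable def CuntzRep.lTwo (n : ℕ) [NeZero n] : CuntzRep n where
  carrier := lp (fun _ : ℕ => ℂ) 2 →L[ℂ] lp (fun _ : ℕ => ℂ) 2
  cstar := { }
  nontrivial := by
    have : Nontrivial (lp (fun _ : ℕ => ℂ) 2) :=
      ⟨lp.single 2 0 1, 0, fun h => by simpa using congrArg (fun x => x.1 0) h⟩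
    infer_instance
  gen := _
  isCuntz := HilbertBasis.isCuntzFamily (HilbertBasis.ofRepr (.refl ℂ _))
    ((Equiv.prodComm _ _).trans (Nat.divModEquiv n).symm)

/-- A unital homomorphism into a nonzero algebra has a nonzero source. -/
theorem CuntzAlgebra.nontrivial (n : ℕ) [NeZero n] : Nontrivial (CuntzAlgebra n) :=
  (CuntzAlgebra.eval (CuntzRep.lTwo n)).toRingHom.domain_nontrivial

theorem exists_injective_thompsonHigman_hom (n : ℕ) (hn : 2 ≤ n) :
    ∃ f : ThompsonHigman n →* (CuntzAlgebra n)ˣ, Function.Injective f := by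
  have : NeZero n := ⟨by omega⟩
  have := CuntzAlgebra.nontrivial n
  exact ⟨_, (isCuntzFamily_cuntzGen n).thompsonHom_injective hn⟩

theorem mainTheorem4 :
    (∃ f : ThompsonV →* (CuntzAlgebra 2)ˣ, Function.Injective f) ∧
    (∀ n : ℕ, 2 ≤ n → ∃ f : ThompsonHigman n →* (CuntzAlgebra n)ˣ, Function.Injective f) :=
  ⟨exists_injective_thompsonHigman_hom 2 le_rfl, exists_injective_thompsonHigman_hom⟩
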